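/- Let $\ell,n,m\ge 0$ be integers, $C\in\mathbb R^{n\times m}$, $A\in\mathbb R^{\ell\times n}$, $B\in\mathbb R^{\ell\times m}$, and let $\mathcal K\subseteq\mathbb R^{n\times m}$ be a nonempty closed convex cone, with dual cone $\mathcal K^\star=\{W\in\mathbb R^{n\times m}:\langle W,X\rangle\ge 0\ \forall X\in\mathcal K\}$ for the inner product $\langle W,X\rangle=\mathrm{tr}(W^\top X)$. Put $g(X)=\langle C,X\rangle$ if $AX=B$ and $X\in\mathcal K$, and $g(X)=+\infty$ otherwise. Let $M,\gamma>0$, and consider one of the following three choices of a space $\mathcal X$ of matrices, a regularizer $\Omega$ on it, and a function $\Omega^\star(\alpha,Y,V_{11},V_{22})$ of $\alpha\in\mathbb R^{n\times m}$, $Y,V_{11}\in\mathbb R^{n\times n}$, $V_{22}\in\mathbb R^{m\times m}$, with constraints on $(\alpha,V_{11},V_{22})$. 1. (Spectral norm, rectangular) $\mathcal X=\mathbb R^{n\times m}$; $\Omega(X)=0$ if $\|X\|_\sigma\le M$ and $+\infty$ otherwise; $\Omega^\star=\frac M2\langle Y,V_{11}\rangle+\frac M2\langle \mathbb I_m,V_{22}\rangle$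 subject to $\begin{pmatrix}V_{11}&\alpha\\ \alpha^\top&V_{22}\end{pmatrix}\succeq 0$. 2. (Spectral norm, symmetric) $m=n$, $\mathcal X$ is the space of symmetric matrices and $\mathcal K\subseteq\mathcal X$; $\Omega$ as in 1; $\Omega^\star=M\langle Y,V_{11}+V_{22}\rangle$ subject to $\alpha=V_{11}-V_{22}$, $V_{11}\succeq0$, $V_{22}\succeq 0$. 3. (Frobenius norm) $\mathcal X=\mathbb R^{n\times m}$; $\Omega(X)=\frac1{2\gamma}\|X\|_F^2$; $\Omega^\star=\frac\gamma2\langle\alpha,Y\alpha\rangle$, with no constraint (and no dependence on $V_{11},V_{22}$). For $Y\in\mathbb R^{n\times n}$ let $$f(Y)=\inf\{g(X)+\Omega(X): X\in\mathcal X,\ X=YX\},\qquad h(\alpha)=\sup\{\langle B,\Pi\rangle:\Pi\in\mathbb R^{\ell\times m},\ C-\alpha-A^\top\Pi\in\mathcal K^\star\},$$ $$F(Y)=\sup\{h(\alpha)-\Omega^\star(\alpha,Y,V_{11},V_{22}):(\alpha,V_{11},V_{22})\text{ satisfies the constraints}\},$$ all with values in $[-\infty,+\infty]$. The Lagrange dual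 of the problem defining $f(Y)$ is the maximization over $\Pi\in\mathbb R^{\ell\times m}$, $S\in\mathcal K^\star$, $\beta\in\mathbb R^{n\times m}$ of $$\inf_{X\in\mathcal X}\ \langle C,X\rangle+\langle\Pi,B-AX\rangle-\langle S,X\rangle+\langle\beta,X-YX\rangle+\Omega(X).$$ (a) Let $Y$ be an orthogonal projection matrix ($Y=Y^\top=Y^2$), and suppose that the problem defining $f(Y)$ is either infeasible, or satisfies strong duality, i.e. $f(Y)$ equals the optimal value of its Lagrange dual. Then the infimum defining $f(Y)$ is attained, and $f(Y)=F(Y)$ (both are $+\infty$ in the infeasible case). If moreover the problem is feasible and its Lagrange dual optimum is attained, then there are $\alpha$ and $\Pi$ with $C-\alpha-A^\top\Pi\in\mathcal K^\star$, $h(\alpha)=\langle B,\Pi\rangle$ and $f(Y)=h(\alpha)+\sup_{V_{11},V_{22}}\{-\Omega^\star(\alpha,Y,V_{11},V_{22})\}$, the supremum being over the $(V_{11},V_{22})$ that satisfy the constraints with $\alpha$; that is, the maximum over $\alpha$ and the maximum defining $h(\alpha)$ are attained (and in case 3 the whole maximum is). (b) For fixed $(\alpha,V_{11},V_{22})$,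 $\Omega^\star(\alpha,Y,V_{11},V_{22})$ is an affine function of $Y$, and its constraints do not involve $Y$. Consequently $F$ is a convex function on $\mathbb R^{n\times n}$; it coincides with $f$ at every orthogonal projection matrix $Y$ as in (a). -/

import Mathlib

namespace LowRank

/-- Real `n × m` matrices. -/
abbrev Mat (n m : ℕ) : Type := Matrix (Fin n) (Fin m) ℝ

/-- The Euclidean (trace) inner product of two matrices of the same size. -/
def ip {n m : ℕ} (X Z : Mat n m) : ℝ := ∑ i, ∑ j, X i j * Z i j

/-- The spectral norm: the operator norm between Euclidean spaces. -/
noncomputable def specNorm {n m : ℕ} (X : Mat n m) : ℝ :=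
  ‖LinearMap.toContinuousLinearMap (Matrix.toEuclideanLin (𝕜 := ℝ) X)‖

/-- The set of `n × n` orthogonal projection matrices. -/
def orthProj (n : ℕ) : Set (Mat n n) := {Y | Y.IsSymm ∧ Y * Y = Y}

/-- Data of the conic problem: cost `C`, linear system `A X = B`, and a cone `K`.
Mathlib's `ProperCone` is a nonempty closed convex cone (neither solid nor pointed is required). -/
structure ConicProblem (l n m : ℕ) where
  C : Mat n m
  A : Mat l n
  B : Mat l m
  K : ProperCone ℝ (Mat n m)

/-- A regularizer together with its conjugate: the space the variable `X` lives in, the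
extended-valued penalty `Ω`, the constraints on `(α, V₁₁, V₂₂)` that go with the conjugate, and
the formula of the conjugate `Ω⋆(α, Y, V₁₁, V₂₂)` where these constraints hold. -/
structure Regularizer (n m : ℕ) where
  space : Set (Mat n m)
  pen : Mat n m → EReal
  dualCons : Mat n m → Mat n n → Mat m m → Prop
  conj : Mat n m → Mat n n → Mat n n → Mat m m → ℝ

open Classical in
/-- The indicator of the spectral-norm ball of radius `M`. -/
noncomputable def spectralPen {n m : ℕ} (M : ℝ) (X : Mat n m) : EReal :=
  if specNorm X ≤ M then 0 else ⊤

/-- Spectral-norm regularizer, rectangular matrices. -/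
noncomputable def spectralRect (n m : ℕ) (M : ℝ) : Regularizer n m where
  space := Set.univ
  pen := spectralPen M
  dualCons := fun α V₁₁ V₂₂ => (Matrix.fromBlocks V₁₁ α α.transpose V₂₂).PosSemidef
  conj := fun _ Y V₁₁ V₂₂ => M / 2 * ip Y V₁₁ + M / 2 * ip 1 V₂₂

/-- Spectral-norm regularizer, symmetric matrices. -/
noncomputable def spectralSymm (n : ℕ) (M : ℝ) : Regularizer n n where
  space := {X | X.IsSymm}
  pen := spectralPen M
  dualCons := fun α V₁₁ V₂₂ => α = V₁₁ - V₂₂ ∧ V₁₁.PosSemidef ∧ V₂₂.PosSemidef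
  conj := fun _ Y V₁₁ V₂₂ => M * ip Y (V₁₁ + V₂₂)

/-- Frobenius-norm regularizer; its conjugate does not involve `V₁₁`, `V₂₂`. -/
noncomputable def frobeniusReg (n m : ℕ) (γ : ℝ) : Regularizer n m where
  space := Set.univ
  pen := fun X => ((1 / (2 * γ) * ip X X : ℝ) : EReal)
  dualCons := fun _ _ _ => True
  conj := fun α Y _ _ => γ / 2 * ip α (Y * α)

/-- The three admissible regularizers, with positive parameters. -/
inductive IsAdmissible : ∀ {n m : ℕ}, Regularizer n m → Prop
  | spectralRect (n m : ℕ) (M : ℝ) (hM : 0 < M) : IsAdmissible (spectralRect n m M)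
  | spectralSymm (n : ℕ) (M : ℝ) (hM : 0 < M) : IsAdmissible (spectralSymm n M)
  | frobenius (n m : ℕ) (γ : ℝ) (hγ : 0 < γ) : IsAdmissible (frobeniusReg n m γ)

section

variable {l n m : ℕ}

open Classical in
/-- The unregularized cost `g(X)`: `⟨C, X⟩` if `A X = B` and `X ∈ K`, and `+∞` otherwise. -/
noncomputable def cost (P : ConicProblem l n m) (X : Mat n m) : EReal :=
  if P.A * X = P.B ∧ X ∈ P.K then ((ip P.C X : ℝ) : EReal) else ⊤

/-- The dual cone of `K`. -/
def dualCone (P : ConicProblem l n m) : Set (Mat n m) :=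
  {W | ∀ X ∈ P.K, 0 ≤ ip W X}

/-- The optimal value `f(Y)` of: minimize `g(X) + Ω(X)` subject to `X = Y X`. -/
noncomputable def innerValue (P : ConicProblem l n m) (R : Regularizer n m) (Y : Mat n n) :
    EReal :=
  ⨅ (X : Mat n m) (_ : X ∈ R.space) (_ : X = Y * X), cost P X + R.pen X

/-- The inner problem at `Y` has a point of finite cost. -/
def Feasible (P : ConicProblem l n m) (R : Regularizer n m) (Y : Mat n n) : Prop :=
  ∃ X ∈ R.space, X = Y * X ∧ cost P X + R.pen X < ⊤

/-- The Lagrange dual function of the inner problem at `Y`, with multipliers `Θ` for `A X = B`,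
`S` for `X ∈ K` and `β` for `X = Y X`. -/
noncomputable def lagrangeDual (P : ConicProblem l n m) (R : Regularizer n m) (Y : Mat n n)
    (Θ : Mat l m) (S β : Mat n m) : EReal :=
  ⨅ (X : Mat n m) (_ : X ∈ R.space),
    ((ip P.C X + ip Θ (P.B - P.A * X) - ip S X + ip β (X - Y * X) : ℝ) : EReal) + R.pen X

/-- Strong duality for the inner problem at `Y`: no gap between its optimal value and the optimal
value of its Lagrange dual. -/
def StrongDuality (P : ConicProblem l n m) (R : Regularizer n m) (Y : Mat n n) : Prop :=
  innerValue P R Y =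
    ⨆ (Θ : Mat l m) (S : Mat n m) (_ : S ∈ dualCone P) (β : Mat n m), lagrangeDual P R Y Θ S β

/-- Some multipliers attain the optimal value of the inner problem at `Y`. -/
def DualAttained (P : ConicProblem l n m) (R : Regularizer n m) (Y : Mat n n) : Prop :=
  ∃ (Θ : Mat l m) (S : Mat n m) (β : Mat n m),
    S ∈ dualCone P ∧ lagrangeDual P R Y Θ S β = innerValue P R Y

/-- The conic dual function: `h(α)` is the supremum of `⟨B, Θ⟩` over `C - α - Aᵀ Θ ∈ K⋆`
(so `-∞` if there is no such `Θ`). -/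
noncomputable def conicDual (P : ConicProblem l n m) (α : Mat n m) : EReal :=
  ⨆ (Θ : Mat l m) (_ : P.C - α - P.A.transpose * Θ ∈ dualCone P), ((ip P.B Θ : ℝ) : EReal)

/-- The optimal value of: maximize `h(α) - Ω⋆(α, Y, V₁₁, V₂₂)` over `(α, V₁₁, V₂₂)` subject to the
constraints that belong to `Ω⋆`. -/
noncomputable def saddleValue (P : ConicProblem l n m) (R : Regularizer n m) (Y : Mat n n) :
    EReal :=
  ⨆ (α : Mat n m) (V₁₁ : Mat n n) (V₂₂ : Mat m m) (_ : R.dualCons α V₁₁ V₂₂),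
    conicDual P α - ((R.conj α Y V₁₁ V₂₂ : ℝ) : EReal)

end

end LowRank
open LowRank

/-! Give the penalized variable its own copy: minimize `⟨C, X⟩ + Ω(Z)` over `X ∈ K` and `Z = Y Z`,
subject to `A X = B` and `X - Z = 0`. The set `valueSet` of residuals and upper bounds of the cost
is convex. It is also closed (`isClosed_valueSet`): `Ω` plus any linear functional has compact
sublevel sets, so convergent costs and residuals confine `Z`, hence `X`. Closedness gives attainment
(`exists_eq_innerValue`), and separating an unreached point from the set gives multipliers
(`exists_multipliers`). Thus `f(Y)` is the supremum over `α` of `h(α)` plus the infimum of `⟨α, Z⟩ +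
Ω(Z)` over `Z = Y Z`.

It remains to identify this infimum with the supremum of `-Ω⋆` over `(V₁₁, V₂₂)`
(`Regularizer.IsConjugate`); here `Y` has to be a projection. For the Frobenius norm one completes
the square. For the spectral norm the infimum is `-M` times the nuclear norm of `G = Y α` (of `G = Y
α Y` with `α` symmetrized in the symmetric case), and the smoothed root `(GᵀG + δ²)^{1/2}` yields
both a nearly optimal `Z` and nearly optimal `V₁₁, V₂₂`. An `ε` of slack is needed, since the
supremum over `(V₁₁, V₂₂)` may not be attained.

`F` is convex because its epigraph is an intersection of half-spaces, `Ω⋆` being affine in `Y`. -/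

namespace LowRank

open Matrix

variable {l n m : ℕ}

/-! ### The trace inner product. -/

theorem ip_eq_trace (X Z : Mat n m) : ip X Z = (Xᵀ * Z).trace := by
  simp only [ip, Matrix.trace, Matrix.diag, Matrix.mul_apply, Matrix.transpose_apply]
  exact Finset.sum_comm

theorem ip_comm (X Z : Mat n m) : ip X Z = ip Z X := by
  simp [ip, mul_comm]

theorem ip_add_right (W X Z : Mat n m) : ip W (X + Z) = ip W X + ip W Z := by
  simp [ip, mul_add, Finset.sum_add_distrib]

theorem ip_smul_right (c : ℝ) (X Z : Mat n m) : ip X (c • Z) = c * ip X Z := by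
  simp only [ip, Matrix.smul_apply, smul_eq_mul, Finset.mul_sum]
  exact Finset.sum_congr rfl fun _ _ => Finset.sum_congr rfl fun _ _ => by ring

theorem ip_neg_right (X Z : Mat n m) : ip X (-Z) = -ip X Z := by
  simp [ip]

theorem ip_sub_right (W X Z : Mat n m) : ip W (X - Z) = ip W X - ip W Z := by
  rw [sub_eq_add_neg, ip_add_right, ip_neg_right, sub_eq_add_neg]

theorem ip_add_left (W X Z : Mat n m) : ip (X + Z) W = ip X W + ip Z W := by
  rw [ip_comm, ip_add_right, ip_comm W, ip_comm W]

theorem ip_sub_left (W X Z : Mat n m) : ip (X - Z) W = ip X W - ip Z W := by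
  rw [ip_comm, ip_sub_right, ip_comm W, ip_comm W]

theorem ip_smul_left (c : ℝ) (X Z : Mat n m) : ip (c • X) Z = c * ip X Z := by
  rw [ip_comm, ip_smul_right, ip_comm]

theorem ip_neg_left (X Z : Mat n m) : ip (-X) Z = -ip X Z := by
  rw [ip_comm, ip_neg_right, ip_comm]

theorem ip_zero_right (X : Mat n m) : ip X 0 = 0 := by simp [ip]

theorem ip_zero_left (X : Mat n m) : ip 0 X = 0 := by simp [ip]

theorem ip_self_nonneg (X : Mat n m) : 0 ≤ ip X X :=
  Finset.sum_nonneg fun _ _ => Finset.sum_nonneg fun _ _ => mul_self_nonneg _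

theorem sq_apply_le_ip_self (X : Mat n m) (i : Fin n) (j : Fin m) : X i j ^ 2 ≤ ip X X := by
  rw [sq]
  refine le_trans ?_ (Finset.single_le_sum (f := fun i => ∑ j, X i j * X i j)
    (fun _ _ => Finset.sum_nonneg fun _ _ => mul_self_nonneg _) (Finset.mem_univ i))
  exact Finset.single_le_sum (f := fun j => X i j * X i j)
    (fun _ _ => mul_self_nonneg _) (Finset.mem_univ j)

theorem ip_transpose_mul (A : Mat l n) (Θ : Mat l m) (X : Mat n m) :
    ip (Aᵀ * Θ) X = ip Θ (A * X) := by
  rw [ip_eq_trace, ip_eq_trace, Matrix.transpose_mul, Matrix.transpose_transpose, Matrix.mul_assoc]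

theorem ip_transpose_transpose (X Z : Mat n m) : ip Xᵀ Zᵀ = ip X Z := by
  simp only [ip, Matrix.transpose_apply]
  exact Finset.sum_comm

theorem continuous_ip_right (W : Mat n m) : Continuous fun X : Mat n m => ip W X := by
  unfold ip
  fun_prop

theorem exists_ip_eq (f : Mat n m →ₗ[ℝ] ℝ) : ∃ W : Mat n m, ∀ X, f X = ip W X := by
  refine ⟨Matrix.of fun i j => f (Matrix.single i j 1), fun X => ?_⟩
  conv_lhs => rw [Matrix.matrix_eq_sum_single X]
  simp only [map_sum, ip, Matrix.of_apply]
  refine Finset.sum_congr rfl fun i _ => Finset.sum_congr rfl fun j _ => ?_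
  have : Matrix.single i j (X i j) = X i j • Matrix.single i j (1 : ℝ) := by
    rw [Matrix.smul_single, smul_eq_mul, mul_one]
  rw [this, map_smul, smul_eq_mul, mul_comm]

theorem isCompact_of_isClosed_of_abs_apply_le {S : Set (Mat n m)} (hS : IsClosed S) (c : ℝ)
    (hc : ∀ X ∈ S, ∀ i j, |X i j| ≤ c) : IsCompact S := by
  have hbox : IsCompact (Set.univ.pi fun _ : Fin n => Set.univ.pi fun _ : Fin m =>
      Set.Icc (-c) c) :=
    isCompact_univ_pi fun _ => isCompact_univ_pi fun _ => isCompact_Icc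
  exact hbox.of_isClosed_subset hS fun X hX i _ j _ => abs_le.1 (hc X hX i j)

/-! ### Semidefinite matrices, the spectral norm and square roots. -/

open scoped MatrixOrder Matrix.Norms.L2Operator in
-- With `V = BᴴB`, cyclicity turns the trace into that of `B W Bᴴ`.
theorem trace_mul_nonneg_of_posSemidef {ι : Type*} [Fintype ι] [DecidableEq ι]
    {V W : Matrix ι ι ℝ} (hV : V.PosSemidef) (hW : W.PosSemidef) : 0 ≤ (V * W).trace := by
  obtain ⟨B, rfl⟩ := CStarAlgebra.nonneg_iff_eq_star_mul_self.mp hV.nonneg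
  rw [Matrix.star_eq_conjTranspose]
  rw [Matrix.mul_assoc, Matrix.trace_mul_comm]
  exact (hW.mul_mul_conjTranspose_same B).trace_nonneg

theorem ip_nonneg_of_posSemidef {V W : Mat n n} (hV : V.PosSemidef) (hW : W.PosSemidef) :
    0 ≤ ip V W := by
  rw [ip_eq_trace]
  exact trace_mul_nonneg_of_posSemidef hV.transpose hW

theorem posSemidef_transpose_mul_self {ι κ : Type*} [Fintype ι] [Fintype κ] (X : Matrix ι κ ℝ) :
    (Xᵀ * X).PosSemidef := by
  simpa using Matrix.posSemidef_conjTranspose_mul_self X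

theorem posSemidef_transpose_mul_mul_same {ι κ : Type*} [Fintype ι] [Fintype κ]
    {V : Matrix ι ι ℝ} (hV : V.PosSemidef) (X : Matrix ι κ ℝ) : (Xᵀ * V * X).PosSemidef := by
  simpa using hV.conjTranspose_mul_mul_same X

theorem posSemidef_mul_mul_transpose_same {ι κ : Type*} [Fintype ι] [Fintype κ]
    {V : Matrix ι ι ℝ} (hV : V.PosSemidef) (X : Matrix κ ι ℝ) : (X * V * Xᵀ).PosSemidef := by
  simpa using hV.mul_mul_conjTranspose_same X

/-- The quadratic form of `M² - XᵀX` at `v` is `(M‖v‖)² - ‖Xv‖²`. -/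
theorem specNorm_le_iff {M : ℝ} (hM : 0 ≤ M) (X : Mat n m) :
    specNorm X ≤ M ↔ (M ^ 2 • (1 : Mat m m) - Xᵀ * X).PosSemidef := by
  have key : ∀ v : Fin m → ℝ, star v ⬝ᵥ ((M ^ 2 • (1 : Mat m m) - Xᵀ * X) *ᵥ v) =
      (M * ‖WithLp.toLp 2 v‖) ^ 2 - ‖Matrix.toEuclideanLin X (WithLp.toLp 2 v)‖ ^ 2 := by
    intro v
    rw [mul_pow, EuclideanSpace.real_norm_sq_eq, EuclideanSpace.real_norm_sq_eq,
      Matrix.sub_mulVec, dotProduct_sub, Matrix.smul_mulVec, Matrix.one_mulVec, dotProduct_smul,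
      ← Matrix.mulVec_mulVec, Matrix.dotProduct_mulVec, Matrix.vecMul_transpose]
    simp [dotProduct, sq]
  have hs : (M ^ 2 • (1 : Mat m m) - Xᵀ * X).IsHermitian := by
    simp [Matrix.IsHermitian]
  rw [specNorm, ContinuousLinearMap.opNorm_le_iff hM]
  constructor
  · intro h
    refine .of_dotProduct_mulVec_nonneg hs fun v => ?_
    rw [key, sub_nonneg]
    exact pow_le_pow_left₀ (norm_nonneg _) (h (WithLp.toLp 2 v)) 2
  · intro h v
    have := h.dotProduct_mulVec_nonneg (WithLp.ofLp v)
    rw [key, sub_nonneg] at this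
    exact le_of_sq_le_sq this (by positivity)

theorem abs_apply_le_of_specNorm_le {M : ℝ} (hM : 0 ≤ M) {X : Mat n m} (hX : specNorm X ≤ M)
    (i : Fin n) (j : Fin m) : |X i j| ≤ M := by
  have h := ((specNorm_le_iff hM X).1 hX).diag_nonneg (i := j)
  simp only [Matrix.sub_apply, Matrix.smul_apply, Matrix.one_apply_eq, smul_eq_mul, mul_one,
    Matrix.mul_apply, Matrix.transpose_apply, sub_nonneg] at h
  refine abs_le_of_sq_le_sq ?_ hM
  rw [sq (X i j)]
  exact (Finset.single_le_sum (f := fun i => X i j * X i j)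
    (fun _ _ => mul_self_nonneg _) (Finset.mem_univ i)).trans h

theorem specNorm_zero : specNorm (0 : Mat n m) = 0 := by
  simp [specNorm]

theorem continuous_specNorm : Continuous (specNorm : Mat n m → ℝ) := by
  have h : Continuous ((LinearMap.toContinuousLinearMap.toLinearMap ∘ₗ
      (Matrix.toEuclideanLin (𝕜 := ℝ) (m := Fin n) (n := Fin m)).toLinearMap)) :=
    LinearMap.continuous_of_finiteDimensional _
  exact h.norm

theorem convex_specNorm_le (M : ℝ) : Convex ℝ {X : Mat n m | specNorm X ≤ M} := by
  have h := (convexOn_univ_norm (E := EuclideanSpace ℝ (Fin m) →L[ℝ] EuclideanSpace ℝ (Fin n))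
    ).comp_linearMap (LinearMap.toContinuousLinearMap.toLinearMap ∘ₗ
      (Matrix.toEuclideanLin (𝕜 := ℝ) (m := Fin n) (n := Fin m)).toLinearMap)
  simpa using! h.convex_le M

/-- For a symmetric matrix `G` and `ε > 0`, the square root `Q` of `G² + ε²`, and its inverse. -/
theorem exists_sqrt_sq_add {G : Mat n n} (hG : G.IsSymm) {ε : ℝ} (hε : 0 < ε) :
    ∃ Q T : Mat n n, Q * T = 1 ∧ Q.IsSymm ∧ T.PosSemidef ∧ Q * Q = G * G + ε ^ 2 • 1 ∧
      G * T = T * G ∧ (Q + G).PosSemidef ∧ (Q - G).PosSemidef ∧ ε * T.trace ≤ n := by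
  have hH : G.IsHermitian := by simpa [Matrix.IsHermitian, Matrix.IsSymm] using hG
  obtain ⟨U, d, hU, hU', hGd⟩ : ∃ (U : Mat n n) (d : Fin n → ℝ), Uᵀ * U = 1 ∧ U * Uᵀ = 1 ∧
      G = U * Matrix.diagonal d * Uᵀ := by
    refine ⟨hH.eigenvectorUnitary, hH.eigenvalues, ?_, ?_, ?_⟩
    · exact Unitary.coe_star_mul_self hH.eigenvectorUnitary
    · exact Unitary.coe_mul_star_self hH.eigenvectorUnitary
    · exact hH.spectral_theorem
  have hmul : ∀ a b : Fin n → ℝ, (U * Matrix.diagonal a * Uᵀ) * (U * Matrix.diagonal b * Uᵀ) =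
      U * Matrix.diagonal (fun i => a i * b i) * Uᵀ := by
    intro a b
    rw [← Matrix.diagonal_mul_diagonal]
    calc _ = U * Matrix.diagonal a * (Uᵀ * U) * Matrix.diagonal b * Uᵀ := by
          simp only [Matrix.mul_assoc]
      _ = _ := by rw [hU, Matrix.mul_one, Matrix.mul_assoc U]
  have hone : U * Matrix.diagonal (fun _ => 1) * Uᵀ = 1 := by
    rw [Matrix.diagonal_one, Matrix.mul_one, hU']
  have hpos : ∀ a : Fin n → ℝ, 0 ≤ a → (U * Matrix.diagonal a * Uᵀ).PosSemidef := fun a ha => by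
    simpa using (Matrix.PosSemidef.diagonal ha).mul_mul_conjTranspose_same U
  set q : Fin n → ℝ := fun i => √(d i ^ 2 + ε ^ 2) with hq
  have hq2 : ∀ i, q i * q i = d i ^ 2 + ε ^ 2 := fun i => Real.mul_self_sqrt (by positivity)
  have hq0 : ∀ i, 0 < q i := fun i => Real.sqrt_pos.2 (by positivity)
  -- This bound controls the trace of the inverse; the next one makes `Q ± G` positive semidefinite.
  have hqε : ∀ i, ε ≤ q i := fun i => Real.le_sqrt_of_sq_le (by nlinarith [sq_nonneg (d i)])
  have hqd : ∀ i, |d i| ≤ q i := fun i =>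
    Real.le_sqrt_of_sq_le (by rw [sq_abs]; nlinarith [sq_nonneg ε])
  refine ⟨U * Matrix.diagonal q * Uᵀ, U * Matrix.diagonal (fun i => (q i)⁻¹) * Uᵀ,
    ?_, ?_, hpos _ fun i => (inv_pos.2 (hq0 i)).le, ?_, ?_, ?_, ?_, ?_⟩
  · rw [hmul, ← hone]
    simp only [mul_inv_cancel₀ (hq0 _).ne']
  · simpa [Matrix.IsHermitian, Matrix.IsSymm] using
      (hpos q fun i => (hq0 i).le).isHermitian
  · rw [hGd, hmul, hmul, ← hone, ← Matrix.smul_mul, ← Matrix.mul_smul, ← Matrix.add_mul,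
      ← Matrix.mul_add, ← Matrix.diagonal_smul, Matrix.diagonal_add]
    simp [hq2, sq]
  · rw [hGd, hmul, hmul]
    simp only [mul_comm]
  · rw [hGd, ← Matrix.add_mul, ← Matrix.mul_add, Matrix.diagonal_add]
    exact hpos _ fun i => by have := abs_le.1 (hqd i); simp only [Pi.zero_apply]; linarith
  · rw [hGd, ← Matrix.sub_mul, ← Matrix.mul_sub, Matrix.diagonal_sub]
    exact hpos _ fun i => by have := abs_le.1 (hqd i); simp only [Pi.zero_apply]; linarith
  · rw [Matrix.trace_mul_comm, ← Matrix.mul_assoc, hU, Matrix.one_mul, Matrix.trace_diagonal,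
      Finset.mul_sum]
    calc ∑ i, ε * (q i)⁻¹ ≤ ∑ _i : Fin n, (1 : ℝ) := by
          refine Finset.sum_le_sum fun i _ => ?_
          rw [← div_eq_mul_inv, div_le_one (hq0 i)]
          exact hqε i
      _ = n := by simp

open scoped MatrixOrder Matrix.Norms.L2Operator in
-- Writes `GᵀG`, for rectangular `G`, as the square of a symmetric matrix, so that
-- `exists_sqrt_sq_add` applies.
theorem exists_isSymm_mul_self_eq {S : Mat n n} (hS : S.PosSemidef) :
    ∃ H : Mat n n, H.IsSymm ∧ H * H = S := by
  refine ⟨CFC.sqrt S, ?_, CFC.sqrt_mul_sqrt_self S hS.nonneg⟩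
  simpa [Matrix.IsHermitian, Matrix.IsSymm] using
    (Matrix.nonneg_iff_posSemidef.1 (CFC.sqrt_nonneg S)).isHermitian

end LowRank
-- Duality for a coercive penalty with a known conjugate.
namespace LowRank

open Filter Topology

variable {l n m : ℕ}

/-- Local convexity serves the Hahn–Banach separation, first countability the sequential proof of
closedness. -/
instance : LocallyConvexSpace ℝ (Mat n m) :=
  inferInstanceAs (LocallyConvexSpace ℝ (Fin n → Fin m → ℝ))

instance : FirstCountableTopology (Mat n m) :=
  inferInstanceAs (FirstCountableTopology (Fin n → Fin m → ℝ))

/-- A closed convex penalty, minimal at `0`, that dominates every linear functional. -/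
structure Regularizer.IsCoercive (R : Regularizer n m) : Prop where
  convex_space : Convex ℝ R.space
  isClosed_space : IsClosed R.space
  zero_mem : (0 : Mat n m) ∈ R.space
  pen_nonneg : ∀ X, 0 ≤ R.pen X
  pen_zero : R.pen 0 = 0
  convex_epi : Convex ℝ {p : Mat n m × ℝ | R.pen p.1 ≤ (p.2 : EReal)}
  isClosed_epi : IsClosed {p : Mat n m × ℝ | R.pen p.1 ≤ (p.2 : EReal)}
  isCompact_sublevel : ∀ (C : Mat n m) (t : ℝ),
    IsCompact {X | R.pen X ≤ ((t - ip C X : ℝ) : EReal)}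

/-- `R.conj` is the conjugate of the penalty on the matrices fixed by `Y`: its negative is a lower
bound of `⟨α, X⟩ + Ω(X)`, and it is approximately sharp once `α` is replaced by a matrix that
defines the same functional on the space of the variable. -/
structure Regularizer.IsConjugate (R : Regularizer n m) (Y : Mat n n) : Prop where
  neg_conj_le : ∀ (α : Mat n m) (V₁₁ : Mat n n) (V₂₂ : Mat m m), R.dualCons α V₁₁ V₂₂ →
    ∀ X ∈ R.space, X = Y * X → ∀ w : ℝ, R.pen X ≤ (w : EReal) →
      -R.conj α Y V₁₁ V₂₂ ≤ ip α X + w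
  exists_le_neg_conj : ∀ α : Mat n m, ∃ α' : Mat n m, (∀ X ∈ R.space, ip α' X = ip α X) ∧
    ∀ r : ℝ, (∀ X ∈ R.space, X = Y * X → ∀ w : ℝ, R.pen X ≤ (w : EReal) → r ≤ ip α X + w) →
      ∀ ε > 0, ∃ (V₁₁ : Mat n n) (V₂₂ : Mat m m), R.dualCons α' V₁₁ V₂₂ ∧
        r - ε ≤ -R.conj α' Y V₁₁ V₂₂

variable {P : ConicProblem l n m} {R : Regularizer n m} {Y : Mat n n}

theorem Regularizer.IsCoercive.nonneg_of_pen_le (hR : R.IsCoercive) {X : Mat n m} {w : ℝ}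
    (h : R.pen X ≤ (w : EReal)) : 0 ≤ w :=
  EReal.coe_nonneg.1 ((hR.pen_nonneg X).trans h)

/-- Where the sum is negative, `X` lies in the compact sublevel set at `0`, on which `⟨C, ·⟩` is
bounded below. -/
theorem Regularizer.IsCoercive.exists_le_ip_add (hR : R.IsCoercive) (C : Mat n m) :
    ∃ b : ℝ, ∀ (X : Mat n m) (w : ℝ), R.pen X ≤ (w : EReal) → b ≤ ip C X + w := by
  obtain ⟨b, hb⟩ := (hR.isCompact_sublevel C 0).bddBelow_image (continuous_ip_right C).continuousOn
  refine ⟨min b 0, fun X w hw => ?_⟩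
  rcases le_total 0 (ip C X + w) with h | h
  · exact (min_le_right _ _).trans h
  · have hX : X ∈ {X | R.pen X ≤ ((0 - ip C X : ℝ) : EReal)} :=
      hw.trans (EReal.coe_le_coe_iff.2 (by linarith))
    have := hb (Set.mem_image_of_mem _ hX)
    have := hR.nonneg_of_pen_le hw
    exact (min_le_left _ _).trans (by linarith)

theorem cost_add_pen_le_iff (hR : R.IsCoercive) {X : Mat n m} {t : ℝ} :
    cost P X + R.pen X ≤ (t : EReal) ↔
      (P.A * X = P.B ∧ X ∈ P.K) ∧ R.pen X ≤ ((t - ip P.C X : ℝ) : EReal) := by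
  have h0 := hR.pen_nonneg X
  unfold cost
  split_ifs with h
  · simp only [h, and_self, true_and]
    induction hp : R.pen X with
    | bot => simp [hp] at h0
    | top =>
      simp only [top_le_iff, EReal.coe_ne_top, EReal.coe_add_top]
    | coe p =>
      rw [← EReal.coe_add, EReal.coe_le_coe_iff, EReal.coe_le_coe_iff, le_sub_iff_add_le']
  · simp only [h, false_and, iff_false, not_le]
    rw [EReal.top_add_of_ne_bot (fun hb => by simp [hb] at h0)]
    exact EReal.coe_lt_top t

/-- The perturbed constraint residuals and upper bounds of the cost, for the problem in which the
penalized variable is split off the conic one. -/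
def valueSet (P : ConicProblem l n m) (R : Regularizer n m) (Y : Mat n n) :
    Set (Mat l m × Mat n m × ℝ) :=
  {q | ∃ X ∈ P.K, ∃ Z ∈ R.space, ∃ w : ℝ, Z = Y * Z ∧ R.pen Z ≤ (w : EReal) ∧
    q = (P.A * X, X - Z, ip P.C X + w)}

theorem mem_valueSet_iff (hR : R.IsCoercive) {t : ℝ} :
    (P.B, (0 : Mat n m), t) ∈ valueSet P R Y ↔
      ∃ X ∈ R.space, X = Y * X ∧ cost P X + R.pen X ≤ (t : EReal) := by
  constructor
  · rintro ⟨X, hX, Z, hZ, w, hYZ, hw, heq⟩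
    simp only [Prod.mk.injEq] at heq
    obtain ⟨hB, hXZ, ht⟩ := heq
    obtain rfl : X = Z := (sub_eq_zero.1 hXZ.symm)
    refine ⟨X, hZ, hYZ, (cost_add_pen_le_iff hR).2 ⟨⟨hB.symm, hX⟩, ?_⟩⟩
    rwa [ht, add_sub_cancel_left]
  · rintro ⟨X, hX, hYX, h⟩
    obtain ⟨⟨hB, hK⟩, hp⟩ := (cost_add_pen_le_iff hR).1 h
    exact ⟨X, hK, X, hX, _, hYX, hp, by simp [hB]⟩

theorem convex_valueSet (hR : R.IsCoercive) : Convex ℝ (valueSet P R Y) := by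
  rintro _ ⟨X, hX, Z, hZ, w, hYZ, hw, rfl⟩ _ ⟨X', hX', Z', hZ', w', hYZ', hw', rfl⟩ a b ha hb hab
  refine ⟨a • X + b • X', P.K.convex hX hX' ha hb hab, a • Z + b • Z',
    hR.convex_space hZ hZ' ha hb hab, a * w + b * w', ?_,
    hR.convex_epi (x := (Z, w)) (y := (Z', w')) hw hw' ha hb hab, ?_⟩
  · rw [Matrix.mul_add, Matrix.mul_smul, Matrix.mul_smul, ← hYZ, ← hYZ']
  · ext1
    · simp [Matrix.mul_add]
    · ext1
      · simp only [Prod.smul_mk, Prod.mk_add_mk, smul_sub]; abel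
      · simp only [Prod.smul_mk, Prod.mk_add_mk, smul_eq_mul, ip_add_right, ip_smul_right]; ring

/-- Only `Z` needs compactness: `X` is recovered as residual plus `Z`, and `w` from the cost. -/
theorem isClosed_valueSet (hR : R.IsCoercive) : IsClosed (valueSet P R Y) := by
  refine IsSeqClosed.isClosed fun u q hu hq => ?_
  choose X hX Z hZ w hYZ hw heq using hu
  have h1 : Tendsto (fun k => P.A * X k) atTop (𝓝 q.1) :=
    ((continuous_fst.tendsto q).comp hq).congr fun k => by simp [heq]
  have h2 : Tendsto (fun k => X k - Z k) atTop (𝓝 q.2.1) :=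
    (((continuous_fst.comp continuous_snd).tendsto q).comp hq).congr fun k => by simp [heq]
  have h3 : Tendsto (fun k => ip P.C (X k) + w k) atTop (𝓝 q.2.2) :=
    (((continuous_snd.comp continuous_snd).tendsto q).comp hq).congr fun k => by simp [heq]
  have h4 : Tendsto (fun k => ip P.C (Z k) + w k) atTop (𝓝 (q.2.2 - ip P.C q.2.1)) := by
    refine (h3.sub (((continuous_ip_right P.C).tendsto _).comp h2)).congr fun k => ?_
    simp only [Function.comp, ip_sub_right]; ring
  -- The extra `1` puts all late `Z k` into a single compact sublevel set.
  have hev : ∀ᶠ k in atTop, Z k ∈ {Z | R.pen Z ≤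
      ((q.2.2 - ip P.C q.2.1 + 1 - ip P.C Z : ℝ) : EReal)} := by
    filter_upwards [h4.eventually_le_const (lt_add_one _)] with k hk
    exact (hw k).trans (EReal.coe_le_coe_iff.2 (by linarith))
  obtain ⟨Z₀, -, φ, hφ, hZφ⟩ :=
    (hR.isCompact_sublevel P.C (q.2.2 - ip P.C q.2.1 + 1)).isSeqCompact.subseq_of_frequently_in
      hev.frequently
  have hXφ : Tendsto (fun k => X (φ k)) atTop (𝓝 (q.2.1 + Z₀)) :=
    ((h2.comp hφ.tendsto_atTop).add hZφ).congr fun k => by simp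
  have hwφ : Tendsto (fun k => w (φ k)) atTop (𝓝 (q.2.2 - ip P.C (q.2.1 + Z₀))) := by
    refine ((h3.comp hφ.tendsto_atTop).sub
      (((continuous_ip_right P.C).tendsto _).comp hXφ)).congr fun k => ?_
    simp
  refine ⟨q.2.1 + Z₀, ?_, Z₀, ?_, q.2.2 - ip P.C (q.2.1 + Z₀), ?_, ?_, ?_⟩
  · exact P.K.isClosed.mem_of_tendsto hXφ (Eventually.of_forall fun k => hX _)
  · exact hR.isClosed_space.mem_of_tendsto hZφ (Eventually.of_forall fun k => hZ _)
  · refine tendsto_nhds_unique hZφ ?_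
    have hc : Continuous fun Z : Mat n m => Y * Z := continuous_const.matrix_mul continuous_id
    exact ((hc.tendsto _).comp hZφ).congr fun k => (hYZ (φ k)).symm
  · exact hR.isClosed_epi.mem_of_tendsto (hZφ.prodMk_nhds hwφ)
      (Eventually.of_forall fun k => hw (φ k))
  · have hc : Continuous fun Z : Mat n m => P.A * Z := continuous_const.matrix_mul continuous_id
    have hA := tendsto_nhds_unique (h1.comp hφ.tendsto_atTop) ((hc.tendsto _).comp hXφ)
    ext1
    · exact hA
    · ext1 <;> simp

theorem innerValue_le (hR : R.IsCoercive) {t : ℝ} (h : (P.B, (0 : Mat n m), t) ∈ valueSet P R Y) :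
    innerValue P R Y ≤ (t : EReal) := by
  obtain ⟨X, hX, hYX, hle⟩ := (mem_valueSet_iff hR).1 h
  exact (iInf₂_le_of_le X hX (iInf_le _ hYX)).trans hle

theorem mem_valueSet_of_innerValue_lt (hR : R.IsCoercive) {t : ℝ}
    (h : innerValue P R Y < (t : EReal)) : (P.B, (0 : Mat n m), t) ∈ valueSet P R Y := by
  simp only [innerValue, iInf_lt_iff] at h
  obtain ⟨X, hX, hYX, hlt⟩ := h
  exact (mem_valueSet_iff hR).2 ⟨X, hX, hYX, hlt.le⟩

theorem innerValue_ne_bot (hR : R.IsCoercive) : innerValue P R Y ≠ ⊥ := by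
  obtain ⟨b, hb⟩ := hR.exists_le_ip_add P.C
  intro h
  have hmem := mem_valueSet_of_innerValue_lt (P := P) (Y := Y) (t := b - 1) hR
    (h ▸ EReal.bot_lt_coe _)
  obtain ⟨X, -, -, hle⟩ := (mem_valueSet_iff hR).1 hmem
  have := hb X _ ((cost_add_pen_le_iff hR).1 hle).2
  linarith

theorem exists_eq_innerValue (hR : R.IsCoercive) :
    ∃ X ∈ R.space, X = Y * X ∧ cost P X + R.pen X = innerValue P R Y := by
  have hge : ∀ X ∈ R.space, X = Y * X → innerValue P R Y ≤ cost P X + R.pen X :=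
    fun X hX hYX => iInf₂_le_of_le X hX (iInf_le _ hYX)
  induction h : innerValue P R Y with
  | bot => exact absurd h (innerValue_ne_bot hR)
  -- If the value is `+∞`, every admissible point attains it; `0` is one.
  | top =>
    have h0 : (0 : Mat n m) = Y * (0 : Mat n m) := by simp
    exact ⟨0, hR.zero_mem, h0, top_le_iff.1 (h ▸ hge 0 hR.zero_mem h0)⟩
  | coe t =>
    have hmem : (P.B, (0 : Mat n m), t) ∈ valueSet P R Y := by
      have hlim : Tendsto (fun s : ℝ => (P.B, (0 : Mat n m), s)) (𝓝[>] t)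
          (𝓝 (P.B, (0 : Mat n m), t)) :=
        ((Continuous.prodMk_right _).comp (Continuous.prodMk_right _)).continuousAt.mono_left
          nhdsWithin_le_nhds
      refine (isClosed_valueSet hR).mem_of_tendsto hlim ?_
      filter_upwards [self_mem_nhdsWithin] with s hs
      exact mem_valueSet_of_innerValue_lt hR (h ▸ EReal.coe_lt_coe_iff.2 hs)
    obtain ⟨X, hX, hYX, hle⟩ := (mem_valueSet_iff hR).1 hmem
    exact ⟨X, hX, hYX, le_antisymm hle (h ▸ hge X hX hYX)⟩

/-- Weak duality. -/
theorem le_of_dual_feasible (hR : R.IsCoercive) (hY : R.IsConjugate Y) {α : Mat n m}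
    {Θ : Mat l m} {V₁₁ : Mat n n} {V₂₂ : Mat m m} (hV : R.dualCons α V₁₁ V₂₂)
    (hΘ : P.C - α - P.A.transpose * Θ ∈ dualCone P) :
    ((ip P.B Θ - R.conj α Y V₁₁ V₂₂ : ℝ) : EReal) ≤ innerValue P R Y := by
  refine EReal.le_of_forall_lt_iff_le.1 fun t ht => ?_
  obtain ⟨X, hX, hYX, hle⟩ := (mem_valueSet_iff hR).1 (mem_valueSet_of_innerValue_lt hR ht)
  obtain ⟨⟨hB, hK⟩, hp⟩ := (cost_add_pen_le_iff hR).1 hle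
  have h1 := hY.neg_conj_le α V₁₁ V₂₂ hV X hX hYX _ hp
  have h2 := hΘ X hK
  rw [ip_sub_left, ip_sub_left, ip_transpose_mul, hB, ip_comm Θ] at h2
  exact EReal.coe_le_coe_iff.2 (by linarith)

theorem saddleValue_le_innerValue (hR : R.IsCoercive) (hY : R.IsConjugate Y) :
    saddleValue P R Y ≤ innerValue P R Y := by
  refine iSup_le fun α => iSup_le fun V₁₁ => iSup_le fun V₂₂ => iSup_le fun hV => ?_
  rw [EReal.sub_le_iff_le_add (.inl (EReal.coe_ne_bot _)) (.inl (EReal.coe_ne_top _))]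
  refine iSup₂_le fun Θ hΘ => ?_
  rw [← EReal.sub_le_iff_le_add (.inl (EReal.coe_ne_bot _)) (.inl (EReal.coe_ne_top _)),
    ← EReal.coe_sub]
  exact le_of_dual_feasible hR hY hV hΘ

theorem le_saddleValue {α : Mat n m} {Θ : Mat l m} {V₁₁ : Mat n n} {V₂₂ : Mat m m}
    (hV : R.dualCons α V₁₁ V₂₂) (hΘ : P.C - α - P.A.transpose * Θ ∈ dualCone P) :
    ((ip P.B Θ - R.conj α Y V₁₁ V₂₂ : ℝ) : EReal) ≤ saddleValue P R Y := by
  refine le_trans ?_ (le_iSup_of_le α <| le_iSup_of_le V₁₁ <| le_iSup_of_le V₂₂ <|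
    le_iSup_of_le hV le_rfl)
  rw [EReal.coe_sub]
  exact EReal.sub_le_sub (le_iSup₂_of_le Θ hΘ le_rfl) le_rfl

/-- A value that is not reached by the problem is a lower bound certified by multipliers. -/
theorem exists_multipliers (hR : R.IsCoercive) {t : ℝ}
    (ht : (P.B, (0 : Mat n m), t) ∉ valueSet P R Y) :
    ∃ (α : Mat n m) (Θ : Mat l m), P.C - α - P.A.transpose * Θ ∈ dualCone P ∧
      ∀ Z ∈ R.space, Z = Y * Z → ∀ w : ℝ, R.pen Z ≤ (w : EReal) →
        t - ip P.B Θ ≤ ip α Z + w := by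
  obtain ⟨f, u, hu, hf⟩ := geometric_hahn_banach_point_closed (convex_valueSet hR)
    (isClosed_valueSet hR) ht
  obtain ⟨Φ, hΦ⟩ := exists_ip_eq (f.toLinearMap ∘ₗ LinearMap.inl ℝ _ _)
  obtain ⟨β, hβ⟩ := exists_ip_eq (f.toLinearMap ∘ₗ LinearMap.inr ℝ _ _ ∘ₗ LinearMap.inl ℝ _ _)
  set c : ℝ := f (0, 0, 1) with hc
  have hdecomp : ∀ (b : Mat l m) (X : Mat n m) (s : ℝ), f (b, X, s) = ip Φ b + ip β X + s * c := by
    intro b X s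
    rw [← hΦ, ← hβ, hc, ← smul_eq_mul, ← map_smul]
    simp [← map_add]
  have hval : ∀ X ∈ P.K, ∀ Z ∈ R.space, Z = Y * Z → ∀ w : ℝ, R.pen Z ≤ (w : EReal) →
      u < ip (P.A.transpose * Φ + β + c • P.C) X - ip β Z + c * w := by
    intro X hX Z hZ hYZ w hw
    have := hf _ ⟨X, hX, Z, hZ, w, hYZ, hw, rfl⟩
    rw [hdecomp, ip_sub_right] at this
    rw [ip_add_left, ip_add_left, ip_transpose_mul, ip_smul_left]
    linarith
  rw [hdecomp, ip_zero_right] at hu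
  have hY0 : (0 : Mat n m) = Y * (0 : Mat n m) := by simp
  have hK0 : (0 : Mat n m) ∈ P.K := P.K.zero_mem
  -- At `X = Z = 0` the bound `w` can be raised at will; for `c < 0` the separation fails once `w ≥
  -- u / c`.
  have hc0 : 0 ≤ c := by
    by_contra! hneg
    have hw0 : 0 ≤ max 0 (u / c) := le_max_left _ _
    have := hval 0 hK0 0 hR.zero_mem hY0 (max 0 (u / c)) (by
      rw [hR.pen_zero]; exact_mod_cast hw0)
    rw [ip_zero_right, ip_zero_right] at this
    have h2 := mul_le_mul_of_nonpos_left (le_max_right 0 (u / c)) hneg.le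
    rw [mul_div_cancel₀ _ hneg.ne] at h2
    linarith
  -- Same argument along a ray of the cone: a negative value is scaled down past `u`.
  have hdual : ∀ X ∈ P.K, 0 ≤ ip (P.A.transpose * Φ + β + c • P.C) X := by
    intro X hX
    by_contra! hneg
    set a := ip (P.A.transpose * Φ + β + c • P.C) X with ha
    have hs : 0 ≤ max 0 (u / a) := le_max_left _ _
    have := hval (max 0 (u / a) • X) (P.K.smul_mem hX hs) 0 hR.zero_mem hY0 0
      (by rw [hR.pen_zero]; simp)
    rw [ip_zero_right, ip_smul_right, ← ha] at this
    have h2 := mul_le_mul_of_nonpos_right (le_max_right 0 (u / a)) hneg.le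
    rw [div_mul_cancel₀ _ hneg.ne] at h2
    linarith
  -- A vertical hyperplane (`c = 0`) certifies infeasibility with margin `δ`. Adding a multiple `s`
  -- of it to the crude bound `b` for `α = C` reaches any `t`. If `c > 0`, dividing by `c` suffices.
  rcases hc0.eq_or_lt with hc0 | hc0
  · obtain ⟨b, hb⟩ := hR.exists_le_ip_add P.C
    rw [← hc0] at hu
    set δ := u - ip Φ P.B with hδ
    have hδ0 : 0 < δ := by linarith
    set s : ℝ := max 0 ((t - b) / δ) with hs
    have hs0 : 0 ≤ s := le_max_left _ _
    have hsδ : t - b ≤ s * δ := (div_le_iff₀ hδ0).1 (le_max_right _ _)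
    refine ⟨P.C - s • β, -(s • Φ), fun X hX => ?_, fun Z hZ hYZ w hw => ?_⟩
    · have := mul_nonneg hs0 (hdual X hX)
      rw [← hc0, zero_smul, add_zero, ip_add_left] at this
      rw [Matrix.mul_neg, Matrix.mul_smul, sub_sub_cancel, sub_neg_eq_add, ip_add_left,
        ip_smul_left, ip_smul_left]
      linarith
    · have h1 := hval 0 hK0 Z hZ hYZ w hw
      rw [ip_zero_right, ← hc0] at h1
      have h2 := hb Z w hw
      have h3 : s * u ≤ s * -ip β Z := mul_le_mul_of_nonneg_left (by linarith) hs0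
      rw [ip_neg_right, ip_smul_right, ip_sub_left, ip_smul_left, ip_comm P.B]
      rw [hδ] at hsδ
      linarith
  · refine ⟨-(c⁻¹ • β), -(c⁻¹ • Φ), fun X hX => ?_, fun Z hZ hYZ w hw => ?_⟩
    · have := mul_nonneg (inv_pos.2 hc0).le (hdual X hX)
      rw [ip_add_left, ip_add_left, ip_smul_left, mul_add, inv_mul_cancel_left₀ hc0.ne'] at this
      rw [Matrix.mul_neg, Matrix.mul_smul, sub_neg_eq_add, sub_neg_eq_add, ip_add_left,
        ip_add_left, ip_smul_left, ip_smul_left]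
      linarith
    · have h1 := hval 0 hK0 Z hZ hYZ w hw
      rw [ip_zero_right] at h1
      have h2 : c⁻¹ * (ip Φ P.B + t * c) ≤ c⁻¹ * (-ip β Z + c * w) :=
        mul_le_mul_of_nonneg_left (by linarith) (inv_pos.2 hc0).le
      rw [mul_add, mul_add, inv_mul_cancel_left₀ hc0.ne', mul_comm t,
        inv_mul_cancel_left₀ hc0.ne'] at h2
      rw [ip_neg_right, ip_smul_right, ip_neg_left, ip_smul_left, ip_comm P.B]
      linarith

/-- Multipliers certify the larger of two intermediate values; the gap between the two pays for the
`ε` in conjugacy. -/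
theorem innerValue_le_saddleValue (hR : R.IsCoercive) (hY : R.IsConjugate Y)
    (hK : ∀ X ∈ P.K, X ∈ R.space) : innerValue P R Y ≤ saddleValue P R Y := by
  by_contra! h
  obtain ⟨s, hs, hs'⟩ := EReal.lt_iff_exists_real_btwn.1 h
  obtain ⟨t, ht, ht'⟩ := EReal.lt_iff_exists_real_btwn.1 hs'
  obtain ⟨α, Θ, hΘ, hα⟩ := exists_multipliers (t := t) hR fun hmem =>
    (ht'.trans_le (innerValue_le hR hmem)).false
  obtain ⟨α', hα', hconj⟩ := hY.exists_le_neg_conj α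
  obtain ⟨V₁₁, V₂₂, hV, hle⟩ := hconj _ hα (t - s) (sub_pos.2 (EReal.coe_lt_coe_iff.1 ht))
  have hΘ' : P.C - α' - P.A.transpose * Θ ∈ dualCone P := fun X hX => by
    have := hΘ X hX
    rw [ip_sub_left, ip_sub_left] at this ⊢
    rwa [hα' X (hK X hX)]
  refine (hs.trans_le (le_trans ?_ (le_saddleValue (Y := Y) hV hΘ'))).false
  exact EReal.coe_le_coe_iff.2 (by linarith)

theorem innerValue_eq_saddleValue (hR : R.IsCoercive) (hY : R.IsConjugate Y)
    (hK : ∀ X ∈ P.K, X ∈ R.space) : innerValue P R Y = saddleValue P R Y :=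
  (innerValue_le_saddleValue hR hY hK).antisymm (saddleValue_le_innerValue hR hY)

/-- On `X = Y X` the `β` term of the Lagrangian vanishes, so `C - AᵀΘ - S` serves as `α`, up to a
change invisible on the space. -/
theorem exists_optimal_of_dualAttained (hR : R.IsCoercive) (hY : R.IsConjugate Y)
    (hK : ∀ X ∈ P.K, X ∈ R.space) (hfeas : Feasible P R Y)
    (hdual : DualAttained P R Y) :
    ∃ (α : Mat n m) (Θ : Mat l m), P.C - α - P.A.transpose * Θ ∈ dualCone P ∧
      conicDual P α = ((ip P.B Θ : ℝ) : EReal) ∧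
      innerValue P R Y = conicDual P α +
        ⨆ (V₁₁ : Mat n n) (V₂₂ : Mat m m) (_ : R.dualCons α V₁₁ V₂₂),
          ((-R.conj α Y V₁₁ V₂₂ : ℝ) : EReal) := by
  obtain ⟨Θ, S, β, hS, hval⟩ := hdual
  obtain ⟨X₀, hX₀, hYX₀, hlt⟩ := hfeas
  have htop : innerValue P R Y ≠ ⊤ :=
    ((iInf₂_le_of_le X₀ hX₀ (iInf_le _ hYX₀)).trans_lt hlt).ne
  obtain ⟨t, ht⟩ : ∃ t : ℝ, innerValue P R Y = t :=
    ⟨_, (EReal.coe_toReal htop (innerValue_ne_bot hR)).symm⟩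
  obtain ⟨α, hα, hconj⟩ := hY.exists_le_neg_conj (P.C - P.A.transpose * Θ - S)
  have hΘ : P.C - α - P.A.transpose * Θ ∈ dualCone P := fun X hX => by
    have := hS X hX
    rw [ip_sub_left, ip_sub_left, hα X (hK X hX), ip_sub_left, ip_sub_left]
    linarith
  have hle : ∀ X ∈ R.space, X = Y * X → ∀ w : ℝ, R.pen X ≤ (w : EReal) →
      t - ip P.B Θ ≤ ip (P.C - P.A.transpose * Θ - S) X + w := by
    intro X hX hYX w hw
    have h1 : lagrangeDual P R Y Θ S β ≤ _ := iInf₂_le X hX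
    rw [hval, ht] at h1
    replace h1 := h1.trans (add_le_add_right hw _)
    rw [← EReal.coe_add, EReal.coe_le_coe_iff, ← hYX, sub_self, ip_zero_right, ip_sub_right,
      ip_comm Θ P.B] at h1
    rw [ip_sub_left, ip_sub_left, ip_transpose_mul]
    linarith
  -- Sandwich: `t - ⟨B, Θ⟩ ≤ σ ≤ t - ⟨B, Θ'⟩` for every feasible `Θ'`, so `Θ` is optimal in `h(α)`.
  set σ : EReal := ⨆ (V₁₁ : Mat n n) (V₂₂ : Mat m m) (_ : R.dualCons α V₁₁ V₂₂),
    ((-R.conj α Y V₁₁ V₂₂ : ℝ) : EReal) with hσ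
  have hσge : ((t - ip P.B Θ : ℝ) : EReal) ≤ σ := by
    refine EReal.ge_of_forall_gt_iff_ge.1 fun s hs => ?_
    obtain ⟨V₁₁, V₂₂, hV, hVle⟩ := hconj _ hle _ (sub_pos.2 (EReal.coe_lt_coe_iff.1 hs))
    refine le_trans (EReal.coe_le_coe_iff.2 ?_)
      (le_iSup_of_le V₁₁ <| le_iSup_of_le V₂₂ <| le_iSup_of_le hV le_rfl)
    linarith
  have hσle : ∀ Θ' : Mat l m, P.C - α - P.A.transpose * Θ' ∈ dualCone P →
      σ ≤ ((t - ip P.B Θ' : ℝ) : EReal) := by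
    refine fun Θ' hΘ' => iSup_le fun V₁₁ => iSup_le fun V₂₂ => iSup_le fun hV =>
      EReal.coe_le_coe_iff.2 ?_
    have := le_of_dual_feasible hR hY hV hΘ'
    rw [ht, EReal.coe_le_coe_iff] at this
    linarith
  have hσeq : σ = ((t - ip P.B Θ : ℝ) : EReal) := (hσle Θ hΘ).antisymm hσge
  have hcd : conicDual P α = ((ip P.B Θ : ℝ) : EReal) := by
    refine le_antisymm (iSup₂_le fun Θ' hΘ' => EReal.coe_le_coe_iff.2 ?_)
      (le_iSup₂_of_le Θ hΘ le_rfl)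
    have := hσle Θ' hΘ'
    rw [hσeq, EReal.coe_le_coe_iff] at this
    linarith
  refine ⟨α, Θ, hΘ, hcd, ?_⟩
  rw [hcd, ← hσ, hσeq, ht, ← EReal.coe_add, add_sub_cancel]

theorem convex_epigraph_saddleValue
    (hR : ∀ (α : Mat n m) (V₁₁ : Mat n n) (V₂₂ : Mat m m),
      ∃ L : Mat n n →ᵃ[ℝ] ℝ, ∀ Y, R.conj α Y V₁₁ V₂₂ = L Y) :
    Convex ℝ {p : Mat n n × ℝ | saddleValue P R p.1 ≤ (p.2 : EReal)} := by
  have hset : {p : Mat n n × ℝ | saddleValue P R p.1 ≤ (p.2 : EReal)} =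
      ⋂ (α : Mat n m) (V₁₁ : Mat n n) (V₂₂ : Mat m m) (_ : R.dualCons α V₁₁ V₂₂)
        (Θ : Mat l m) (_ : P.C - α - P.A.transpose * Θ ∈ dualCone P),
        {p : Mat n n × ℝ | ip P.B Θ ≤ p.2 + R.conj α p.1 V₁₁ V₂₂} := by
    ext p
    simp only [saddleValue, conicDual, Set.mem_ofPred_eq, iSup_le_iff, Set.mem_iInter,
      EReal.sub_le_iff_le_add (.inl (EReal.coe_ne_bot _)) (.inl (EReal.coe_ne_top _)),
      ← EReal.coe_add, EReal.coe_le_coe_iff]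
  rw [hset]
  refine convex_iInter fun α => convex_iInter fun V₁₁ => convex_iInter fun V₂₂ =>
    convex_iInter fun _ => convex_iInter fun Θ => convex_iInter fun _ => ?_
  obtain ⟨L, hL⟩ := hR α V₁₁ V₂₂
  intro p hp q hq a b ha hb hab
  simp only [Set.mem_ofPred_eq, hL] at hp hq ⊢
  rw [Prod.fst_add, Prod.smul_fst, Prod.smul_fst, Convex.combo_affine_apply hab]
  simp only [Prod.snd_add, Prod.smul_snd, smul_eq_mul]
  calc ip P.B Θ = a * ip P.B Θ + b * ip P.B Θ := by rw [← add_mul, hab, one_mul]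
    _ ≤ a * (p.2 + L p.1) + b * (q.2 + L q.1) := by gcongr
    _ = _ := by ring

end LowRank
namespace LowRank

open Matrix

variable {l n m : ℕ}

/-! ### Coercivity -/

theorem spectralPen_nonneg (M : ℝ) (X : Mat n m) : 0 ≤ spectralPen M X := by
  unfold spectralPen; split_ifs <;> simp

theorem spectralPen_zero {M : ℝ} (hM : 0 ≤ M) : spectralPen M (0 : Mat n m) = 0 := by
  simp [spectralPen, specNorm_zero, hM]

theorem spectralPen_le_iff {M w : ℝ} {X : Mat n m} :
    spectralPen M X ≤ (w : EReal) ↔ specNorm X ≤ M ∧ 0 ≤ w := by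
  unfold spectralPen
  split_ifs with h
  · simp [h]
  · simp [h]

theorem convex_epi_spectralPen (M : ℝ) :
    Convex ℝ {p : Mat n m × ℝ | spectralPen M p.1 ≤ (p.2 : EReal)} := by
  simpa only [spectralPen_le_iff] using! (convex_specNorm_le M).prod (convex_Ici (0 : ℝ))

theorem isClosed_epi_spectralPen (M : ℝ) :
    IsClosed {p : Mat n m × ℝ | spectralPen M p.1 ≤ (p.2 : EReal)} := by
  simpa only [spectralPen_le_iff] using!
    (isClosed_le continuous_specNorm continuous_const).prod (isClosed_Ici (a := (0 : ℝ)))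

theorem isCompact_sublevel_spectralPen {M : ℝ} (hM : 0 ≤ M) (C : Mat n m) (t : ℝ) :
    IsCompact {X : Mat n m | spectralPen M X ≤ ((t - ip C X : ℝ) : EReal)} := by
  simp only [spectralPen_le_iff]
  refine isCompact_of_isClosed_of_abs_apply_le
    ((isClosed_le continuous_specNorm continuous_const).inter
      (isClosed_le continuous_const (continuous_const.sub (continuous_ip_right C)))) M
    fun X hX => abs_apply_le_of_specNorm_le hM hX.1

theorem isCoercive_spectralRect {M : ℝ} (hM : 0 ≤ M) : (spectralRect n m M).IsCoercive where
  convex_space := convex_univ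
  isClosed_space := isClosed_univ
  zero_mem := Set.mem_univ _
  pen_nonneg := spectralPen_nonneg M
  pen_zero := spectralPen_zero hM
  convex_epi := convex_epi_spectralPen M
  isClosed_epi := isClosed_epi_spectralPen M
  isCompact_sublevel := isCompact_sublevel_spectralPen hM

theorem isCoercive_spectralSymm {M : ℝ} (hM : 0 ≤ M) : (spectralSymm n M).IsCoercive where
  convex_space := fun _ hX _ hZ a b _ _ _ => (hX.smul a).add (hZ.smul b)
  isClosed_space := isClosed_eq continuous_id.matrix_transpose continuous_id
  zero_mem := Matrix.isSymm_zero
  pen_nonneg := spectralPen_nonneg M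
  pen_zero := spectralPen_zero hM
  convex_epi := convex_epi_spectralPen M
  isClosed_epi := isClosed_epi_spectralPen M
  isCompact_sublevel := isCompact_sublevel_spectralPen hM

theorem continuous_ip_self : Continuous fun X : Mat n m => ip X X := by
  unfold ip
  fun_prop

/-- The convexity defect is `a b ⟨X - Z, X - Z⟩`. -/
theorem convexOn_ip_self : ConvexOn ℝ Set.univ fun X : Mat n m => ip X X := by
  refine ⟨convex_univ, fun X _ Z _ a b ha hb hab => ?_⟩
  have h := mul_nonneg (mul_nonneg ha hb) (ip_self_nonneg (X - Z))
  obtain rfl : b = 1 - a := by linarith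
  simp only [ip_add_left, ip_add_right, ip_smul_left, ip_smul_right, ip_sub_left, ip_sub_right,
    ip_comm Z X, smul_eq_mul] at h ⊢
  linarith

theorem isCoercive_frobeniusReg {γ : ℝ} (hγ : 0 < γ) : (frobeniusReg n m γ).IsCoercive where
  convex_space := convex_univ
  isClosed_space := isClosed_univ
  zero_mem := Set.mem_univ _
  pen_nonneg X := EReal.coe_nonneg.2 (mul_nonneg (by positivity) (ip_self_nonneg X))
  pen_zero := by simp [frobeniusReg, ip_zero_left]
  convex_epi := by
    simp only [frobeniusReg, EReal.coe_le_coe_iff]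
    simpa using! (convexOn_ip_self.smul (c := 1 / (2 * γ)) (by positivity)).convex_epigraph
  isClosed_epi := by
    simp only [frobeniusReg, EReal.coe_le_coe_iff]
    exact isClosed_le ((continuous_ip_self.comp continuous_fst).const_mul _) continuous_snd
  isCompact_sublevel C t := by
    simp only [frobeniusReg, EReal.coe_le_coe_iff]
    refine isCompact_of_isClosed_of_abs_apply_le
      (isClosed_le (continuous_ip_self.const_mul _)
        (continuous_const.sub (continuous_ip_right C)))
      (√(2 * γ * t + γ ^ 2 * ip C C) + ip C C * γ + γ) fun X hX i j => ?_
    -- Completing the square bounds `X + γ C`; the shift is removed with `|x| ≤ x² + 1`.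
    have h1 : ip (X + γ • C) (X + γ • C) ≤ 2 * γ * t + γ ^ 2 * ip C C := by
      have h2 : 2 * γ * (1 / (2 * γ) * ip X X) ≤ 2 * γ * (t - ip C X) :=
        mul_le_mul_of_nonneg_left hX (by positivity)
      rw [← mul_assoc, mul_one_div_cancel (by positivity), one_mul] at h2
      simp only [ip_add_left, ip_add_right, ip_smul_left, ip_smul_right, ip_comm X C]
      linarith
    have h3 : |X i j + γ * C i j| ≤ √(2 * γ * t + γ ^ 2 * ip C C) :=
      Real.abs_le_sqrt ((sq_apply_le_ip_self (X + γ • C) i j).trans h1)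
    have h4 : |C i j| ≤ ip C C + 1 := by
      have := sq_apply_le_ip_self C i j
      rw [← sq_abs] at this
      nlinarith [sq_nonneg (|C i j| - 1)]
    have h5 : |γ * C i j| ≤ ip C C * γ + γ := by
      rw [abs_mul, abs_of_pos hγ]
      nlinarith
    have h6 := abs_sub (X i j + γ * C i j) (γ * C i j)
    rw [add_sub_cancel_right] at h6
    linarith

/-! ### Conjugacy -/

/-- Complete the square in `X + γ Y α`; the minimizer `-γ Y α` is fixed by `Y`. -/
theorem isConjugate_frobeniusReg {γ : ℝ} (hγ : 0 < γ) {Y : Mat n n} (hY : Y ∈ orthProj n) :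
    (frobeniusReg n m γ).IsConjugate Y where
  neg_conj_le α V₁₁ V₂₂ _ X _ hYX w hw := by
    simp only [frobeniusReg, EReal.coe_le_coe_iff] at hw ⊢
    have h1 : ip (Y * α) (Y * α) = ip α (Y * α) := by
      nth_rewrite 1 [← hY.1.eq]
      rw [ip_transpose_mul, ← Matrix.mul_assoc, hY.2]
    have h2 : ip (Y * α) X = ip α X := by
      nth_rewrite 1 [← hY.1.eq]
      rw [ip_transpose_mul, ← hYX]
    have h3 := mul_nonneg (show 0 ≤ 1 / (2 * γ) by positivity)
      (ip_self_nonneg (X + γ • (Y * α)))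
    simp only [ip_add_left, ip_add_right, ip_smul_left, ip_smul_right, ip_comm X, h1, h2] at h3
    have h4 : 1 / (2 * γ) * (ip X X + γ * ip α X + (γ * ip α X + γ * (γ * ip α (Y * α)))) =
        1 / (2 * γ) * ip X X + ip α X + γ / 2 * ip α (Y * α) := by
      field_simp
      ring
    linarith
  exists_le_neg_conj α := by
    refine ⟨α, fun _ _ => rfl, fun r hr ε hε => ⟨0, 0, trivial, ?_⟩⟩
    have h := hr (-(γ • (Y * α))) (Set.mem_univ _)
      (by rw [Matrix.mul_neg, Matrix.mul_smul, ← Matrix.mul_assoc, hY.2]) _ le_rfl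
    have h1 : ip (Y * α) (Y * α) = ip α (Y * α) := by
      nth_rewrite 1 [← hY.1.eq]
      rw [ip_transpose_mul, ← Matrix.mul_assoc, hY.2]
    simp only [ip_neg_left, ip_neg_right, ip_smul_left, ip_smul_right, h1] at h
    have h4 : -(γ * ip α (Y * α)) + 1 / (2 * γ) * -(-(γ * (γ * ip α (Y * α)))) =
        -(γ / 2 * ip α (Y * α)) := by
      field_simp
      ring
    simp only [frobeniusReg]
    linarith

/-- The scaled approximate polar factor `G (GᵀG + δ²)^{-1/2}` has spectral norm at most `M`. -/
theorem specNorm_smul_mul_le {M δ : ℝ} (hM : 0 ≤ M) {G : Mat n m} {Q T : Mat m m}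
    (hQT : Q * T = 1) (hT : T.IsSymm) (hQ : Q * Q = Gᵀ * G + δ ^ 2 • 1) :
    specNorm (-(M • (G * T))) ≤ M := by
  have hTQ : T * Q = 1 := mul_eq_one_comm.1 hQT
  have hG : Gᵀ * G = Q * Q - δ ^ 2 • 1 := by rw [hQ, add_sub_cancel_right]
  have h : M ^ 2 • (1 : Mat m m) - (-(M • (G * T)))ᵀ * (-(M • (G * T))) =
      (M ^ 2 * δ ^ 2) • (Tᵀ * T) := by
    calc _ = M ^ 2 • ((1 : Mat m m) - T * (Gᵀ * G) * T) := by
          simp only [Matrix.transpose_neg, Matrix.neg_mul, Matrix.mul_neg, neg_neg,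
            Matrix.transpose_smul, smul_neg, Matrix.smul_mul, Matrix.mul_smul,
            smul_smul, Matrix.transpose_mul, hT.eq,
            Matrix.mul_assoc, smul_sub, sq]
      _ = M ^ 2 • ((1 : Mat m m) - ((T * Q) * (Q * T) - δ ^ 2 • (T * T))) := by
          rw [hG]
          simp only [Matrix.mul_sub, Matrix.sub_mul, Matrix.mul_smul, Matrix.smul_mul,
            Matrix.mul_one, Matrix.mul_assoc]
      _ = _ := by rw [hQT, hTQ, Matrix.mul_one, sub_sub_cancel, smul_smul, hT.eq]
  rw [specNorm_le_iff hM, h]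
  exact (posSemidef_transpose_mul_self T).smul (by positivity)

theorem trace_transpose_mul_self_mul {δ : ℝ} {G : Mat n m} {Q T : Mat m m}
    (hQT : Q * T = 1) (hQ : Q * Q = Gᵀ * G + δ ^ 2 • 1) :
    (Gᵀ * G * T).trace = Q.trace - δ ^ 2 * T.trace := by
  have hG : Gᵀ * G = Q * Q - δ ^ 2 • 1 := by rw [hQ, add_sub_cancel_right]
  rw [hG, Matrix.sub_mul, Matrix.mul_assoc, hQT, Matrix.mul_one, Matrix.smul_mul, Matrix.one_mul,
    Matrix.trace_sub, Matrix.trace_smul, smul_eq_mul]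

/-- The Gram matrix of `[M Y, X]` plus `M² - XᵀX` in the last corner. -/
theorem posSemidef_fromBlocks_of_specNorm_le {M : ℝ} (hM : 0 ≤ M) {Y : Mat n n}
    (hY : Y ∈ orthProj n) {X : Mat n m} (hYX : X = Y * X) (hX : specNorm X ≤ M) :
    (Matrix.fromBlocks (M ^ 2 • Y) (M • X) (M • Xᵀ) (M ^ 2 • (1 : Mat m m))).PosSemidef := by
  have hXY : Xᵀ * Y = Xᵀ := by
    conv_rhs => rw [hYX, Matrix.transpose_mul, hY.1.eq]
  have h : Matrix.fromBlocks (M ^ 2 • Y) (M • X) (M • Xᵀ) (M ^ 2 • (1 : Mat m m)) =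
      (Matrix.fromCols (M • Y) X)ᵀ * Matrix.fromCols (M • Y) X +
        (Matrix.fromCols (0 : Mat m n) 1)ᵀ * (M ^ 2 • (1 : Mat m m) - Xᵀ * X) *
          Matrix.fromCols (0 : Mat m n) 1 := by
    rw [Matrix.transpose_fromCols, Matrix.transpose_fromCols, Matrix.fromRows_mul_fromCols,
      Matrix.fromRows_mul, Matrix.fromRows_mul_fromCols, Matrix.fromBlocks_add]
    simp [hY.1.eq, hY.2, ← hYX, hXY, smul_smul, sq]
  rw [h]
  refine .add ?_ ?_
  · exact posSemidef_transpose_mul_self _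
  · exact posSemidef_transpose_mul_mul_same ((specNorm_le_iff hM X).1 hX) _

theorem trace_fromBlocks (V : Mat n n) (X : Mat n m) (Z : Mat m n) (W : Mat m m) :
    (Matrix.fromBlocks V X Z W).trace = V.trace + W.trace := by
  simp [Matrix.trace]

/-- The lower bound pairs two semidefinite block matrices. For sharpness, test `X = -M G T` against
`V₁₁ = α T αᵀ`, `V₂₂ = Q`, where `Q = (GᵀG + δ²)^{1/2}` and `T = Q⁻¹`; the loss is at most `M δ² tr
T ≤ M δ m`. -/
theorem isConjugate_spectralRect {M : ℝ} (hM : 0 < M) {Y : Mat n n} (hY : Y ∈ orthProj n) :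
    (spectralRect n m M).IsConjugate Y where
  neg_conj_le α V₁₁ V₂₂ hV X _ hYX w hw := by
    obtain ⟨hX, hw⟩ := spectralPen_le_iff.1 hw
    have h := trace_mul_nonneg_of_posSemidef
      (posSemidef_fromBlocks_of_specNorm_le hM.le hY hYX hX) hV
    rw [Matrix.fromBlocks_multiply, trace_fromBlocks] at h
    simp only [Matrix.trace_add, Matrix.smul_mul, Matrix.trace_smul, smul_eq_mul] at h
    have h1 : (Y * V₁₁).trace = ip Y V₁₁ := by rw [ip_eq_trace, hY.1.eq]
    have h2 : (X * αᵀ).trace = ip α X := by rw [ip_eq_trace, Matrix.trace_mul_comm]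
    have h3 : (Xᵀ * α).trace = ip α X := by rw [← ip_eq_trace, ip_comm]
    have h4 : ((1 : Mat m m) * V₂₂).trace = ip 1 V₂₂ := by rw [ip_eq_trace, Matrix.transpose_one]
    rw [h1, h2, h3, h4] at h
    have h5 : 0 ≤ 2 * M * (ip α X + (M / 2 * ip Y V₁₁ + M / 2 * ip 1 V₂₂)) := by linarith
    have h6 := nonneg_of_mul_nonneg_right h5 (by positivity)
    simp only [spectralRect]
    linarith
  exists_le_neg_conj α := by
    refine ⟨α, fun _ _ => rfl, fun r hr ε hε => ?_⟩
    set G : Mat n m := Y * α with hG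
    obtain ⟨δ, hδ, hδε⟩ : ∃ δ : ℝ, 0 < δ ∧ M * δ * m ≤ ε := by
      refine ⟨ε / (M * (m + 1)), by positivity, ?_⟩
      rw [mul_div_assoc', mul_div_mul_left _ _ hM.ne', div_mul_eq_mul_div,
        div_le_iff₀ (by positivity)]
      nlinarith
    obtain ⟨H, hH, hHG⟩ := exists_isSymm_mul_self_eq (posSemidef_transpose_mul_self G)
    obtain ⟨Q, T, hQT, hQs, hT, hQQ, -, -, -, htr⟩ := exists_sqrt_sq_add hH hδ
    rw [hHG] at hQQ
    have hTs : T.IsSymm := by simpa [Matrix.IsHermitian, Matrix.IsSymm] using hT.isHermitian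
    have hTQ : T * Q = 1 := mul_eq_one_comm.1 hQT
    have hGG : Gᵀ * G = αᵀ * (Y * α) := by
      rw [hG, Matrix.transpose_mul, hY.1.eq, Matrix.mul_assoc, ← Matrix.mul_assoc Y, hY.2]
    have htrace := trace_transpose_mul_self_mul hQT hQQ
    have hip : ip α (G * T) = Q.trace - δ ^ 2 * T.trace := by
      rw [ip_eq_trace, ← htrace, hGG, ← Matrix.mul_assoc]
    have hipY : ip Y (α * T * αᵀ) = Q.trace - δ ^ 2 * T.trace := by
      rw [ip_eq_trace, hY.1.eq, ← htrace, hGG, ← Matrix.mul_assoc, Matrix.trace_mul_comm,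
        ← Matrix.mul_assoc, ← Matrix.mul_assoc, ← Matrix.mul_assoc]
    refine ⟨α * T * αᵀ, Q, ?_, ?_⟩
    · have hblock : Matrix.fromBlocks (α * T * αᵀ) α αᵀ Q =
          Matrix.fromRows α Q * T * (Matrix.fromRows α Q)ᵀ := by
        rw [Matrix.transpose_fromRows, Matrix.fromRows_mul, Matrix.fromRows_mul_fromCols, hQT,
          hQs.eq, Matrix.one_mul, Matrix.one_mul, Matrix.mul_assoc α T Q, hTQ, Matrix.mul_one]
      change (Matrix.fromBlocks (α * T * αᵀ) α αᵀ Q).PosSemidef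
      rw [hblock]
      exact posSemidef_mul_mul_transpose_same hT _
    · have h := hr (-(M • (G * T))) (Set.mem_univ _)
        (by rw [Matrix.mul_neg, Matrix.mul_smul, ← Matrix.mul_assoc, hG, ← Matrix.mul_assoc, hY.2])
        0 (spectralPen_le_iff.2 ⟨specNorm_smul_mul_le hM.le hQT hTs hQQ, le_rfl⟩)
      rw [ip_neg_right, ip_smul_right, hip] at h
      have h1 : ip 1 Q = Q.trace := by rw [ip_eq_trace, Matrix.transpose_one, Matrix.one_mul]
      simp only [spectralRect]
      rw [hipY, h1]
      have h2 : M * δ * (δ * T.trace) ≤ M * δ * m := mul_le_mul_of_nonneg_left htr (by positivity)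
      have h3 : 0 ≤ M * δ * (δ * T.trace) := by
        have := hT.trace_nonneg
        positivity
      linarith

/-- `2M (M Y + X) = (M Y + X)² + Y (M² - X²) Y`. -/
theorem posSemidef_smul_add_of_specNorm_le {M : ℝ} (hM : 0 < M) {Y : Mat n n}
    (hY : Y ∈ orthProj n) {X : Mat n n} (hXs : X.IsSymm) (hYX : X = Y * X)
    (hX : specNorm X ≤ M) : (M • Y + X).PosSemidef := by
  have hXY : X * Y = X := by
    have := congrArg Matrix.transpose hYX
    rwa [Matrix.transpose_mul, hY.1.eq, hXs.eq, eq_comm] at this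
  have h : M • Y + X = (2 * M)⁻¹ • ((M • Y + X)ᵀ * (M • Y + X) +
      Yᵀ * (M ^ 2 • (1 : Mat n n) - Xᵀ * X) * Y) := by
    have h1 : (M • Y + X)ᵀ * (M • Y + X) = M ^ 2 • Y + (2 * M) • X + X * X := by
      rw [Matrix.transpose_add, Matrix.transpose_smul, hY.1.eq, hXs.eq, Matrix.add_mul,
        Matrix.mul_add, Matrix.mul_add, Matrix.smul_mul, Matrix.smul_mul, Matrix.mul_smul,
        Matrix.mul_smul, hY.2, ← hYX, hXY]
      module
    have h2 : Yᵀ * (M ^ 2 • (1 : Mat n n) - Xᵀ * X) * Y = M ^ 2 • Y - X * X := by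
      rw [hY.1.eq, hXs.eq, Matrix.mul_sub, Matrix.sub_mul, Matrix.mul_smul, Matrix.smul_mul,
        Matrix.mul_one, hY.2, ← Matrix.mul_assoc Y, ← hYX, Matrix.mul_assoc, hXY]
    have h3 : M ^ 2 • Y + (2 * M) • X + X * X + (M ^ 2 • Y - X * X) = (2 * M) • (M • Y + X) := by
      module
    rw [h1, h2, h3, smul_smul, inv_mul_cancel₀ (by positivity), one_smul]
  rw [h]
  refine .smul (.add (posSemidef_transpose_mul_self _) ?_) (by positivity)
  exact posSemidef_transpose_mul_mul_same ((specNorm_le_iff hM.le X).1 hX) Y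

/-- A matrix that dominates the symmetric matrix `α`, provided `Q` dominates `YαY`, and whose trace
against the projection `Y` is close to that of `Q`. -/
theorem posSemidef_dominate_add {Y α Q : Mat n n} (hY : Y ∈ orthProj n) (hα : α.IsSymm) {δ : ℝ}
    (hδ : 0 < δ) (hQ : (Q + Y * α * Y).PosSemidef) :
    (Y * Q * Y + δ • Y + (1 - Y) * (δ⁻¹ • (α * α) + (2⁻¹ : ℝ) • (1 + α * α)) * (1 - Y) +
      α).PosSemidef := by
  set N : Mat n n := 1 - Y with hN
  have hNs : Nᵀ = N := by rw [hN, Matrix.transpose_sub, hY.1.eq, Matrix.transpose_one]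
  have hYY := hY.2
  have hdec : α = Y * α * Y + Y * α * N + N * α * Y + N * α * N := by
    rw [hN]; noncomm_ring
  have h1 : Yᵀ * (Q + Y * α * Y) * Y = Y * Q * Y + Y * α * Y := by
    rw [hY.1.eq, Matrix.mul_add, Matrix.add_mul]
    congr 1
    rw [← Matrix.mul_assoc, ← Matrix.mul_assoc, hYY, Matrix.mul_assoc, hYY]
  -- This square absorbs the cross terms `Y α N + N α Y` at a cost `δ Y` on the range of `Y`; the
  -- next one absorbs `N α N`.
  have h2 : (δ • Y + α * N)ᵀ * (δ • Y + α * N) =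
      δ • (δ • Y + Y * α * N + N * α * Y + δ⁻¹ • (N * (α * α) * N)) := by
    rw [Matrix.transpose_add, Matrix.transpose_smul, Matrix.transpose_mul, hY.1.eq, hα.eq, hNs,
      Matrix.add_mul, Matrix.mul_add, Matrix.mul_add, Matrix.smul_mul, Matrix.smul_mul,
      Matrix.mul_smul, Matrix.mul_smul, hYY, smul_add, smul_add, smul_add, smul_smul δ δ⁻¹,
      mul_inv_cancel₀ hδ.ne', one_smul]
    simp only [Matrix.mul_assoc]
    abel
  have h3 : ((1 + α) * N)ᵀ * ((1 + α) * N) =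
      N * (1 + α * α) * N + (2 : ℝ) • (N * α * N) := by
    rw [Matrix.transpose_mul, Matrix.transpose_add, Matrix.transpose_one, hα.eq, hNs, two_smul]
    noncomm_ring
  have h : Y * Q * Y + δ • Y + N * (δ⁻¹ • (α * α) + (2⁻¹ : ℝ) • (1 + α * α)) * N + α =
      Yᵀ * (Q + Y * α * Y) * Y + δ⁻¹ • ((δ • Y + α * N)ᵀ * (δ • Y + α * N)) +
        (2⁻¹ : ℝ) • (((1 + α) * N)ᵀ * ((1 + α) * N)) := by
    rw [h1, h2, h3, smul_smul δ⁻¹ δ, inv_mul_cancel₀ hδ.ne', one_smul,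
      smul_add (2⁻¹ : ℝ) (N * _ * N), smul_smul,
      inv_mul_cancel₀ (two_ne_zero' ℝ), one_smul]
    simp only [Matrix.mul_add N, Matrix.add_mul _ _ N, Matrix.mul_smul, Matrix.smul_mul, smul_add]
    conv_lhs => arg 2; rw [hdec]
    abel
  rw [h]
  refine .add (.add ?_ ((posSemidef_transpose_mul_self _).smul (by positivity)))
    ((posSemidef_transpose_mul_self _).smul (by positivity))
  exact posSemidef_transpose_mul_mul_same hQ Y

/-- Blocks living on the kernel of `Y` cost nothing, however large `δ⁻¹` makes them. -/
theorem ip_one_sub_mul_mul {Y : Mat n n} (hY : Y ∈ orthProj n) (W : Mat n n) :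
    ip Y ((1 - Y) * W * (1 - Y)) = 0 := by
  rw [ip_eq_trace, hY.1.eq, ← Matrix.mul_assoc, ← Matrix.mul_assoc, Matrix.mul_sub Y,
    Matrix.mul_one, hY.2, sub_self, Matrix.zero_mul, Matrix.zero_mul, Matrix.trace_zero]

theorem ip_mul_mul_self_le_trace {Y Q : Mat n n} (hY : Y ∈ orthProj n) (hQ : Q.PosSemidef) :
    ip Y (Y * Q * Y) ≤ Q.trace := by
  have hN : (1 - Y).PosSemidef := by
    have := posSemidef_transpose_mul_self (1 - Y)
    rwa [Matrix.transpose_sub, hY.1.eq, Matrix.transpose_one, Matrix.sub_mul, Matrix.mul_sub,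
      Matrix.mul_sub, hY.2, Matrix.mul_one, Matrix.mul_one, Matrix.one_mul, sub_self,
      sub_zero] at this
  have h := ip_nonneg_of_posSemidef hN hQ
  have h1 : ip Y (Y * Q * Y) = ip Y Q := by
    rw [ip_eq_trace, ip_eq_trace, hY.1.eq, Matrix.mul_assoc, ← Matrix.mul_assoc, hY.2,
      ← Matrix.mul_assoc, Matrix.trace_mul_comm, ← Matrix.mul_assoc, hY.2]
  have h2 : ip 1 Q = Q.trace := by rw [ip_eq_trace, Matrix.transpose_one, Matrix.one_mul]
  rw [ip_sub_left, h2] at h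
  linarith

/-- Sharpness needs `D ⪰ ±α` with `⟨Y, D⟩` close to `tr Q`; then `V₁₁, V₂₂ = (D ± α)/2`. Only the
symmetric part of `α` can be such a difference, and it acts alike on symmetric `X`. -/
theorem isConjugate_spectralSymm {M : ℝ} (hM : 0 < M) {Y : Mat n n} (hY : Y ∈ orthProj n) :
    (spectralSymm n M).IsConjugate Y where
  neg_conj_le α V₁₁ V₂₂ hV X hXs hYX w hw := by
    obtain ⟨hX, hw⟩ := spectralPen_le_iff.1 hw
    obtain ⟨rfl, hV₁, hV₂⟩ := hV
    have hXs' : X.IsSymm := hXs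
    have hX' : specNorm (-X) ≤ M := by
      rw [specNorm_le_iff hM.le] at hX ⊢
      simpa using hX
    have h1 := ip_nonneg_of_posSemidef
      (posSemidef_smul_add_of_specNorm_le hM hY hXs' hYX hX) hV₁
    have h2 := ip_nonneg_of_posSemidef
      (posSemidef_smul_add_of_specNorm_le hM hY hXs'.neg (by rw [Matrix.mul_neg, ← hYX]) hX') hV₂
    rw [ip_add_left, ip_smul_left] at h1 h2
    rw [ip_neg_left] at h2
    simp only [spectralSymm, ip_add_right, ip_sub_left, ip_comm V₁₁ X, ip_comm V₂₂ X]
    linarith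
  exists_le_neg_conj α₀ := by
    set α : Mat n n := (2⁻¹ : ℝ) • (α₀ + α₀ᵀ) with hα
    have hαs : α.IsSymm := by
      rw [Matrix.IsSymm, hα, Matrix.transpose_smul, Matrix.transpose_add,
        Matrix.transpose_transpose, add_comm]
    have hαX : ∀ X : Mat n n, X.IsSymm → ip α X = ip α₀ X := by
      intro X hX
      have : ip α₀ᵀ X = ip α₀ X := by
        rw [← ip_transpose_transpose, hX.eq, Matrix.transpose_transpose]
      rw [hα, ip_smul_left, ip_add_left, this]
      ring
    refine ⟨α, hαX, fun r hr ε hε => ?_⟩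
    have hYnn := ip_self_nonneg Y
    -- The budget: `n` for `δ tr T`, and `⟨Y, Y⟩` for the term `δ Y` of `D`.
    obtain ⟨δ, hδ, hδε⟩ : ∃ δ : ℝ, 0 < δ ∧ M * δ * (n + ip Y Y) ≤ ε := by
      refine ⟨ε / (M * (n + ip Y Y + 1)), by positivity, ?_⟩
      rw [mul_div_assoc', mul_div_mul_left _ _ hM.ne', div_mul_eq_mul_div,
        div_le_iff₀ (by positivity)]
      nlinarith
    set G : Mat n n := Y * α * Y with hG
    have hGs : G.IsSymm := by
      rw [Matrix.IsSymm, hG, Matrix.transpose_mul, Matrix.transpose_mul, hY.1.eq, hαs.eq,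
        Matrix.mul_assoc]
    have hYG : Y * G = G := by rw [hG, ← Matrix.mul_assoc, ← Matrix.mul_assoc, hY.2]
    have hGY : G * Y = G := by rw [hG, Matrix.mul_assoc, hY.2]
    obtain ⟨Q, T, hQT, hQs, hT, hQQ, hGT, hQp, hQm, htr⟩ := exists_sqrt_sq_add hGs hδ
    have hTs : T.IsSymm := by simpa [Matrix.IsHermitian, Matrix.IsSymm] using hT.isHermitian
    have hQQ' : Q * Q = Gᵀ * G + δ ^ 2 • 1 := by rw [hGs.eq, hQQ]
    have hQ : Q.PosSemidef := by
      have := (hQp.add hQm).smul (show (0 : ℝ) ≤ 2⁻¹ by positivity)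
      rwa [add_add_sub_cancel, ← two_smul ℝ Q, smul_smul, inv_mul_cancel₀ (two_ne_zero' ℝ),
        one_smul] at this
    have hip : ip α (G * T) = Q.trace - δ ^ 2 * T.trace := by
      have h1 : G * T = Y * (G * T) * Y := by
        rw [← Matrix.mul_assoc, hYG, hGT, Matrix.mul_assoc, hGY]
      rw [← trace_transpose_mul_self_mul hQT hQQ', h1, ip_eq_trace, hαs.eq, hGs.eq,
        ← Matrix.mul_assoc, Matrix.trace_mul_comm, ← Matrix.mul_assoc, ← Matrix.mul_assoc,
        ← Matrix.mul_assoc, ← hG]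
    have hGTs : (G * T).IsSymm := by
      rw [Matrix.IsSymm, Matrix.transpose_mul, hTs.eq, hGs.eq, hGT]
    set D : Mat n n := Y * Q * Y + δ • Y +
      (1 - Y) * (δ⁻¹ • (α * α) + (2⁻¹ : ℝ) • (1 + α * α)) * (1 - Y) with hD
    have hDp : (D + α).PosSemidef := posSemidef_dominate_add hY hαs hδ hQp
    have hDm : (D - α).PosSemidef := by
      have := posSemidef_dominate_add (Q := Q) hY hαs.neg hδ (by
        rwa [Matrix.mul_neg, Matrix.neg_mul, ← sub_eq_add_neg])
      rwa [neg_mul_neg, ← hD, ← sub_eq_add_neg] at this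
    have hDY : ip Y D ≤ Q.trace + δ * ip Y Y := by
      rw [hD, ip_add_right, ip_add_right, ip_one_sub_mul_mul hY, ip_smul_right, add_zero]
      have := ip_mul_mul_self_le_trace hY hQ
      linarith
    refine ⟨(2⁻¹ : ℝ) • (D + α), (2⁻¹ : ℝ) • (D - α), ⟨by module, hDp.smul (by positivity),
      hDm.smul (by positivity)⟩, ?_⟩
    have h := hr (-(M • (G * T))) ((hGTs.smul M).neg)
      (by rw [Matrix.mul_neg, Matrix.mul_smul, ← Matrix.mul_assoc, hYG])
      0 (spectralPen_le_iff.2 ⟨specNorm_smul_mul_le hM.le hQT hTs hQQ', le_rfl⟩)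
    rw [← hαX _ (hGTs.smul M).neg, ip_neg_right, ip_smul_right, hip] at h
    have hsum : (2⁻¹ : ℝ) • (D + α) + (2⁻¹ : ℝ) • (D - α) = D := by module
    simp only [spectralSymm]
    rw [hsum]
    have h2 : M * δ * (δ * T.trace) ≤ M * δ * n := mul_le_mul_of_nonneg_left htr (by positivity)
    have h3 : M * ip Y D ≤ M * (Q.trace + δ * ip Y Y) := mul_le_mul_of_nonneg_left hDY hM.le
    linarith

/-! ### The three regularizers -/

theorem IsAdmissible.isCoercive {R : Regularizer n m} (hR : IsAdmissible R) : R.IsCoercive := by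
  cases hR with
  | spectralRect _ M hM => exact isCoercive_spectralRect hM.le
  | spectralSymm M hM => exact isCoercive_spectralSymm hM.le
  | frobenius _ γ hγ => exact isCoercive_frobeniusReg hγ

theorem IsAdmissible.isConjugate {R : Regularizer n m} (hR : IsAdmissible R) {Y : Mat n n}
    (hY : Y ∈ orthProj n) : R.IsConjugate Y := by
  cases hR with
  | spectralRect _ M hM => exact isConjugate_spectralRect hM hY
  | spectralSymm M hM => exact isConjugate_spectralSymm hM hY
  | frobenius _ γ hγ => exact isConjugate_frobeniusReg hγ hY

/-- The linear functional `⟨·, W⟩`. -/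
def ipRight (W : Mat n m) : Mat n m →ₗ[ℝ] ℝ where
  toFun Y := ip Y W
  map_add' := ip_add_left W
  map_smul' c X := ip_smul_left c X W

theorem IsAdmissible.exists_affineMap {R : Regularizer n m} (hR : IsAdmissible R) (α : Mat n m)
    (V₁₁ : Mat n n) (V₂₂ : Mat m m) : ∃ L : Mat n n →ᵃ[ℝ] ℝ, ∀ Y, R.conj α Y V₁₁ V₂₂ = L Y := by
  cases hR with
  | spectralRect _ M hM =>
    exact ⟨((M / 2) • ipRight V₁₁).toAffineMap + AffineMap.const ℝ _ (M / 2 * ip 1 V₂₂),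
      fun Y => rfl⟩
  | spectralSymm M hM => exact ⟨(M • ipRight (V₁₁ + V₂₂)).toAffineMap, fun Y => rfl⟩
  | frobenius _ γ hγ =>
    -- `⟨α, Y α⟩ = ⟨Y, α αᵀ⟩` is linear in `Y`.
    refine ⟨((γ / 2) • ipRight (α * αᵀ)).toAffineMap, fun Y => ?_⟩
    change γ / 2 * ip α (Y * α) = γ / 2 * ip Y (α * αᵀ)
    rw [ip_comm α, ip_eq_trace, ip_eq_trace, Matrix.transpose_mul, Matrix.trace_mul_comm,
      ← Matrix.mul_assoc, Matrix.trace_mul_comm]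

end LowRank

theorem theorem3 {l n m : ℕ} (P : ConicProblem l n m) (R : Regularizer n m)
    (hR : IsAdmissible R) (hK : ∀ X ∈ P.K, X ∈ R.space) :
    -- equality of the two problems at each projection matrix
    (∀ Y ∈ orthProj n, (¬ Feasible P R Y ∨ StrongDuality P R Y) →
      -- the minimum is attained
      (∃ X ∈ R.space, X = Y * X ∧ cost P X + R.pen X = innerValue P R Y) ∧
      -- the optimal values agree
      innerValue P R Y = saddleValue P R Y ∧
      -- an optimal `α` and an optimal `Θ` exist when the Lagrange dual is attained
      (Feasible P R Y → DualAttained P R Y →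
        ∃ (α : Mat n m) (Θ : Mat l m),
          P.C - α - P.A.transpose * Θ ∈ dualCone P ∧
          conicDual P α = ((ip P.B Θ : ℝ) : EReal) ∧
          innerValue P R Y = conicDual P α +
            ⨆ (V₁₁ : Mat n n) (V₂₂ : Mat m m) (_ : R.dualCons α V₁₁ V₂₂),
              ((-R.conj α Y V₁₁ V₂₂ : ℝ) : EReal))) ∧
    -- the conjugate is affine in `Y`
    (∀ (α : Mat n m) (V₁₁ : Mat n n) (V₂₂ : Mat m m),
      ∃ L : Mat n n →ᵃ[ℝ] ℝ, ∀ Y, R.conj α Y V₁₁ V₂₂ = L Y) ∧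
    -- the common value is convex in `Y`
    Convex ℝ {p : Mat n n × ℝ | saddleValue P R p.1 ≤ (p.2 : EReal)} := by
  -- coercivity makes the duality hypothesis redundant
  refine ⟨fun Y hY _ => ?_, hR.exists_affineMap, convex_epigraph_saddleValue hR.exists_affineMap⟩
  exact ⟨exists_eq_innerValue hR.isCoercive,
    innerValue_eq_saddleValue hR.isCoercive (hR.isConjugate hY) hK,
    exists_optimal_of_dualAttained hR.isCoercive (hR.isConjugate hY) hK⟩
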